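/- **Theorem (Gehrke–Petrişan–Reggio).** Let $\mathbf{Stone}$ be the category of Stone spaces (compact Hausdorff totally disconnected spaces) and continuous maps, $\mathbf{JSL}$ the category of join-semilattices with bottom and maps preserving finite joins, and $2=\{0,1\}$, regarded as a discrete space and as a join-semilattice. For a Stone space $X$, let $\mathbb{V}X$ be the set of all closed subsets of $X$ with the hit-or-miss topology, whose subbasic open sets are $\Diamond U=\{C : C\cap U\neq\emptyset\}$ and $\Box U=\{C : C\cap U=\emptyset\}$ for $U\subseteq X$ clopen. The Vietoris monad $\mathbb{V}$ on $\mathbf{Stone}$ sends $X$ to $\mathbb{V}X$ and a continuous map to its direct-image map; its unit is $x\mapsto\{x\}$ and its multiplication is union. 1. $\mathbb{V}$ is isomorphic, as a monad, to the monad induced by the dual adjunction $\mathbf{Stone}(-,2)\dashv\mathbf{JSL}(-,2)\colon\mathbf{JSL}^{\mathrm{op}}\to\mathbf{Stone}$, where joins in $\mathbf{Stone}(X,2)$ are pointwise and $\mathbf{JSL}(J,2)$ is a subspace of the product space $2^{J}$. In particular $\mathbb{V}X\cong\mathbf{JSL}(\mathbf{Stone}(X,2),2)$; the isomorphism sends a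 closed set $C$ to the morphism $\varphi_C$ with $\varphi_C(g)=0$ if and only if $C\cap g^{-1}(1)=\emptyset$, i.e. to the ideal of all clopen sets disjoint from $C$. 2. Let $\mathcal{P}_f$ be the finite powerset monad on $\mathbf{Set}$, $\mathbf{Kl}_f(\mathcal{P}_f)$ the full subcategory of its Kleisli category on the finite sets, and $U_{\mathcal{P}_f}\colon\mathbf{Kl}_f(\mathcal{P}_f)\to\mathbf{Stone}$ the functor that sends a finite set $X$ to the discrete space $\mathcal{P}_fX\cong 2^X$ and a Kleisli morphism $f\colon X\to\mathcal{P}_fY$ to $f^{\#}\colon\mathcal{P}_fX\to\mathcal{P}_fY$, $S\mapsto\bigcup_{x\in S}f(x)$. Then the right Kan extension of $U_{\mathcal{P}_f}$ along itself exists and is pointwise, and the codensity monad of $U_{\mathcal{P}_f}$ is isomorphic, as a monad, to $\mathbb{V}$. -/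

import Mathlib

open CategoryTheory

universe u v₁ v₂ u₁ u₂

noncomputable section

namespace VietorisCodensity

/-! ## Codensity monads -/

section Codensity

variable {A : Type u₁} {C : Type u₂} [Category.{v₁} A] [Category.{v₂} C]

/-- The functor `Ran_F F` underlying the codensity monad of `F`. -/
abbrev ranSelf (F : A ⥤ C) [F.HasRightKanExtension F] : C ⥤ C :=
  F.rightKanExtension F

/-- The counit `φ : (Ran_F F) F ⟶ F`. -/
abbrev ranSelfCounit (F : A ⥤ C) [F.HasRightKanExtension F] : F ⋙ ranSelf F ⟶ F :=
  F.rightKanExtensionCounit F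

/-- The unit of the codensity monad corresponds to `id : F ⟶ F`. -/
def codensityUnit (F : A ⥤ C) [F.HasRightKanExtension F] : 𝟭 C ⟶ ranSelf F :=
  (ranSelf F).liftOfIsRightKanExtension (ranSelfCounit F) (𝟭 C) F.rightUnitor.hom

/-- The multiplication of the codensity monad corresponds to
`(Ran_F F) (Ran_F F) F ⟶ (Ran_F F) F ⟶ F`, the composite of `(Ran_F F) φ` and `φ`. -/
def codensityMul (F : A ⥤ C) [F.HasRightKanExtension F] :
    ranSelf F ⋙ ranSelf F ⟶ ranSelf F :=
  (ranSelf F).liftOfIsRightKanExtension (ranSelfCounit F) (ranSelf F ⋙ ranSelf F)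
    ((F.associator (ranSelf F) (ranSelf F)).inv ≫
      Functor.whiskerRight (ranSelfCounit F) (ranSelf F) ≫ ranSelfCounit F)

theorem codensityUnit_fac (F : A ⥤ C) [F.HasRightKanExtension F] (a : A) :
    (codensityUnit F).app (F.obj a) ≫ (ranSelfCounit F).app a = 𝟙 (F.obj a) := by
  simp [codensityUnit]

theorem codensityMul_fac (F : A ⥤ C) [F.HasRightKanExtension F] (a : A) :
    (codensityMul F).app (F.obj a) ≫ (ranSelfCounit F).app a =
      (ranSelf F).map ((ranSelfCounit F).app a) ≫ (ranSelfCounit F).app a := by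
  simp [codensityMul]

/-- The codensity monad `(Ran_F F, η, μ)` of a functor `F` whose right Kan extension along itself
exists. -/
def codensityMonad (F : A ⥤ C) [F.HasRightKanExtension F] : Monad C where
  toFunctor := ranSelf F
  η := codensityUnit F
  μ := codensityMul F
  assoc X := by
    have h : Functor.whiskerRight (codensityMul F) (ranSelf F) ≫ codensityMul F =
        (Functor.associator _ _ _).hom ≫
          Functor.whiskerLeft (ranSelf F) (codensityMul F) ≫ codensityMul F := by
      apply (ranSelf F).hom_ext_of_isRightKanExtension (ranSelfCounit F)
      ext a
      have h1 := codensityMul_fac F a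
      simp only [Functor.whiskerLeft_app, NatTrans.comp_app, Functor.whiskerRight_app,
        Category.assoc, Functor.associator_hom_app, Functor.comp_obj, Category.id_comp, h1]
      have h2 := (codensityMul F).naturality ((ranSelfCounit F).app a)
      rw [← Functor.map_comp_assoc, h1, Functor.map_comp_assoc]
      erw [← reassoc_of% h2, h1]
    simpa using NatTrans.congr_app h X
  left_unit X := by
    have h : Functor.whiskerLeft (ranSelf F) (codensityUnit F) ≫ codensityMul F =
        (ranSelf F).rightUnitor.hom := by
      apply (ranSelf F).hom_ext_of_isRightKanExtension (ranSelfCounit F)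
      ext a
      have h1 := codensityMul_fac F a
      have h2 := codensityUnit_fac F a
      have h3 := (codensityUnit F).naturality ((ranSelfCounit F).app a)
      simp only [Functor.whiskerLeft_app, NatTrans.comp_app, Category.assoc,
        Functor.rightUnitor_hom_app, Functor.comp_obj, h1]
      erw [← reassoc_of% h3, h2]
      simp
    simpa using NatTrans.congr_app h X
  right_unit X := by
    have h : Functor.whiskerRight (codensityUnit F) (ranSelf F) ≫ codensityMul F =
        (ranSelf F).leftUnitor.hom := by
      apply (ranSelf F).hom_ext_of_isRightKanExtension (ranSelfCounit F)
      ext a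
      have h1 := codensityMul_fac F a
      have h2 := codensityUnit_fac F a
      simp only [Functor.whiskerLeft_app, NatTrans.comp_app, Functor.whiskerRight_app,
        Category.assoc, h1, Functor.leftUnitor_hom_app]
      rw [← Functor.map_comp_assoc, h2]
      simp
    simpa using NatTrans.congr_app h X

end Codensity

/-! ## The Vietoris monad on Stone spaces -/

section Hyperspace

set_option linter.unusedSectionVars false

/-- The set of closed subsets of `X`. -/
def Hyperspace (X : Type u) [TopologicalSpace X] : Type u := TopologicalSpace.Closeds X

variable {X Y : Type u} [TopologicalSpace X] [TopologicalSpace Y]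

instance hyperspaceSetLike : SetLike (Hyperspace X) X := inferInstanceAs (SetLike (TopologicalSpace.Closeds X) X)

/-- The closed sets that hit `U`. -/
def hit (U : Set X) : Set (Hyperspace X) := {C | ((C : Set X) ∩ U).Nonempty}

/-- The closed sets that miss `U`. -/
def miss (U : Set X) : Set (Hyperspace X) := {C | (C : Set X) ∩ U = ∅}

/-- The hit-or-miss topology: it has the sets `hit U` and `miss U`, for `U` clopen, as subbasis. -/
instance hitOrMiss : TopologicalSpace (Hyperspace X) :=
  TopologicalSpace.generateFrom
    ({S | ∃ U : Set X, IsClopen U ∧ S = hit U} ∪ {S | ∃ U : Set X, IsClopen U ∧ S = miss U})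

theorem Hyperspace.isClosed (C : Hyperspace X) : IsClosed (C : Set X) :=
  TopologicalSpace.Closeds.isClosed' C

theorem Hyperspace.ext {C D : Hyperspace X} (h : ∀ x, x ∈ C ↔ x ∈ D) : C = D := SetLike.ext h

theorem compl_hit (U : Set X) : (hit U)ᶜ = miss U := by
  ext C
  simp [hit, miss, Set.not_nonempty_iff_eq_empty]

theorem isOpen_hit {U : Set X} (hU : IsClopen U) : IsOpen (hit U) :=
  TopologicalSpace.isOpen_generateFrom_of_mem (Or.inl ⟨U, hU, rfl⟩)

theorem isOpen_miss {U : Set X} (hU : IsClopen U) : IsOpen (miss U) :=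
  TopologicalSpace.isOpen_generateFrom_of_mem (Or.inr ⟨U, hU, rfl⟩)

theorem isClopen_hit {U : Set X} (hU : IsClopen U) : IsClopen (hit U) :=
  ⟨⟨by rw [compl_hit]; exact isOpen_miss hU⟩, isOpen_hit hU⟩

theorem continuous_of_hit {Z : Type*} [TopologicalSpace Z] (f : Z → Hyperspace X)
    (h : ∀ U : Set X, IsClopen U → IsClopen (f ⁻¹' hit U)) : Continuous f := by
  refine continuous_generateFrom_iff.2 ?_
  rintro S (⟨U, hU, rfl⟩ | ⟨U, hU, rfl⟩)
  · exact (h U hU).isOpen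
  · rw [← compl_hit, Set.preimage_compl]
    exact (h U hU).compl.isOpen

theorem exists_finite_subcover {K : Set X} (hK : IsCompact K) {S : Set (Set X)}
    (hS : ∀ U ∈ S, IsOpen U) (hKS : K ⊆ ⋃₀ S) : ∃ T ⊆ S, T.Finite ∧ K ⊆ ⋃₀ T := by
  rw [Set.sUnion_eq_biUnion] at hKS
  obtain ⟨T, hTS, hTf, hT⟩ := hK.elim_finite_subcover_image (c := id) hS hKS
  exact ⟨T, hTS, hTf, by rwa [Set.sUnion_eq_biUnion]⟩

variable [CompactSpace X] [T2Space X] [TotallyDisconnectedSpace X]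
variable [CompactSpace Y] [T2Space Y] [TotallyDisconnectedSpace Y]

theorem exists_clopen_of_notMem (C : Hyperspace X) {x : X} (hx : x ∉ C) :
    ∃ U : Set X, IsClopen U ∧ x ∈ U ∧ C ∈ miss U := by
  obtain ⟨U, hU, hxU, hUC⟩ := compact_exists_isClopen_in_isOpen C.isClosed.isOpen_compl hx
  exact ⟨U, hU, hxU, Set.disjoint_left.2 (fun y hy hyU => hUC hyU hy) |>.inter_eq⟩

theorem exists_separating {C D : Hyperspace X} {x : X} (hC : x ∈ C) (hD : x ∉ D) :
    ∃ U : Set X, IsClopen U ∧ C ∈ hit U ∧ D ∈ miss U := by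
  obtain ⟨U, hU, hxU, hUC⟩ := exists_clopen_of_notMem D hD
  exact ⟨U, hU, ⟨x, hC, hxU⟩, hUC⟩

instance hyperspaceTotallySeparated : TotallySeparatedSpace (Hyperspace X) := by
  refine ⟨fun C _ D _ hne => ?_⟩
  have : ∃ x, ¬ (x ∈ C ↔ x ∈ D) := by
    by_contra! h
    exact hne (Hyperspace.ext h)
  obtain ⟨x, hx⟩ := this
  by_cases hC : x ∈ C
  · obtain ⟨U, hU, h1, h2⟩ := exists_separating hC (D := D) (by tauto)
    exact ⟨hit U, miss U, isOpen_hit hU, isOpen_miss hU, h1, h2,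
      by rw [← compl_hit, Set.union_compl_self],
      by rw [← compl_hit]; exact disjoint_compl_right⟩
  · obtain ⟨U, hU, h1, h2⟩ := exists_separating (C := D) (D := C) (x := x) (by tauto) hC
    exact ⟨miss U, hit U, isOpen_miss hU, isOpen_hit hU, h2, h1,
      by rw [← compl_hit, Set.compl_union_self],
      by rw [← compl_hit]; exact disjoint_compl_left⟩

instance hyperspaceCompact : CompactSpace (Hyperspace X) := by
  refine compactSpace_generateFrom rfl fun P hP hcov => ?_
  let O : Set (Set X) := {U | IsClopen U ∧ hit U ∈ P}
  let C : Hyperspace X :=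
    (⟨(⋃₀ O)ᶜ, (isOpen_sUnion fun U hU => hU.1.isOpen).isClosed_compl⟩ :
      TopologicalSpace.Closeds X)
  have hC : ∀ x, x ∈ C ↔ x ∉ ⋃₀ O := fun x => Iff.rfl
  obtain ⟨S, hSP, hCS⟩ : C ∈ ⋃₀ P := hcov ▸ Set.mem_univ C
  rcases hP hSP with ⟨U, hU, rfl⟩ | ⟨W, hW, rfl⟩
  · obtain ⟨x, hx, hxU⟩ := hCS
    exact absurd ⟨U, ⟨hU, hSP⟩, hxU⟩ ((hC x).1 hx)
  · have hWO : W ⊆ ⋃₀ O := fun x hxW => by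
      by_contra h
      have : x ∈ (C : Set X) ∩ W := ⟨(hC x).2 h, hxW⟩
      rw [show (C : Set X) ∩ W = ∅ from hCS] at this
      exact this
    obtain ⟨T, hTO, hTf, hWT⟩ :=
      exists_finite_subcover hW.isClosed.isCompact (fun U hU => hU.1.isOpen) hWO
    refine ⟨insert (miss W) (hit '' T), ?_, (hTf.image _).insert _, ?_⟩
    · rintro S (rfl | ⟨U, hU, rfl⟩)
      · exact hSP
      · exact (hTO hU).2
    · refine Set.eq_univ_of_forall fun D => ?_
      by_cases hD : D ∈ miss W
      · exact ⟨_, Or.inl rfl, hD⟩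
      · rw [← compl_hit, Set.notMem_compl_iff] at hD
        obtain ⟨x, hxD, hxW⟩ := hD
        obtain ⟨U, hU, hxU⟩ := hWT hxW
        exact ⟨hit U, Or.inr ⟨U, hU, rfl⟩, x, hxD, hxU⟩

/-- The direct image of a closed set. -/
def image (f : C(X, Y)) (C : Hyperspace X) : Hyperspace Y :=
  (⟨f '' C, (C.isClosed.isCompact.image f.continuous).isClosed⟩ : TopologicalSpace.Closeds Y)

theorem mem_image (f : C(X, Y)) (C : Hyperspace X) (y : Y) :
    y ∈ image f C ↔ ∃ x ∈ C, f x = y := Iff.rfl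

/-- The closed set `{x}`. -/
def singleton (x : X) : Hyperspace X :=
  (⟨{x}, isClosed_singleton⟩ : TopologicalSpace.Closeds X)

theorem mem_singleton (x y : X) : y ∈ singleton x ↔ y = x := Iff.rfl

theorem isClosed_union (𝒞 : Hyperspace (Hyperspace X)) :
    IsClosed {x : X | ∃ C ∈ 𝒞, x ∈ C} := by
  rw [← isOpen_compl_iff, isOpen_iff_forall_mem_open]
  intro x hx
  let O : Set (Set X) := {U | IsClopen U ∧ x ∈ U}
  have hcov : (𝒞 : Set (Hyperspace X)) ⊆ ⋃₀ (miss '' O) := fun C hC => by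
    obtain ⟨U, hU, hxU, h⟩ := exists_clopen_of_notMem C (x := x) fun h => hx ⟨C, hC, h⟩
    exact ⟨miss U, ⟨U, ⟨hU, hxU⟩, rfl⟩, h⟩
  obtain ⟨T, hTO, hTf, hT⟩ := exists_finite_subcover 𝒞.isClosed.isCompact
    (by rintro S ⟨U, hU, rfl⟩; exact isOpen_miss hU.1) hcov
  obtain ⟨T, hTO', hTf', rfl⟩ := Set.exists_subset_image_finite_and.1 ⟨T, hTO, hTf, rfl⟩
  refine ⟨⋂₀ T, ?_, hTf'.isOpen_sInter fun U hU => (hTO' hU).1.isOpen, fun U hU => (hTO' hU).2⟩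
  rintro y hy ⟨C, hC, hyC⟩
  obtain ⟨_, ⟨U, hU, rfl⟩, hCU⟩ := hT hC
  have : y ∈ (C : Set X) ∩ U := ⟨hyC, hy U hU⟩
  rw [show (C : Set X) ∩ U = ∅ from hCU] at this
  exact this

/-- The union of a closed set of closed sets. -/
def union (𝒞 : Hyperspace (Hyperspace X)) : Hyperspace X :=
  (⟨{x | ∃ C ∈ 𝒞, x ∈ C}, isClosed_union 𝒞⟩ : TopologicalSpace.Closeds X)

theorem mem_union (𝒞 : Hyperspace (Hyperspace X)) (x : X) : x ∈ union 𝒞 ↔ ∃ C ∈ 𝒞, x ∈ C :=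
  Iff.rfl

theorem continuous_image (f : C(X, Y)) : Continuous (image f) := by
  refine continuous_of_hit _ fun U hU => ?_
  have : image f ⁻¹' hit U = hit (f ⁻¹' U) := by
    ext C
    constructor
    · rintro ⟨_, ⟨x, hx, rfl⟩, hxU⟩
      exact ⟨x, hx, hxU⟩
    · rintro ⟨x, hx, hxU⟩
      exact ⟨f x, ⟨x, hx, rfl⟩, hxU⟩
  rw [this]
  exact isClopen_hit (hU.preimage f.continuous)

theorem continuous_singleton : Continuous (singleton : X → Hyperspace X) := by
  refine continuous_of_hit _ fun U hU => ?_
  have : singleton ⁻¹' hit U = U := by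
    ext x
    constructor
    · rintro ⟨_, rfl, hxU⟩
      exact hxU
    · intro hx
      exact ⟨x, rfl, hx⟩
  rwa [this]

theorem continuous_union : Continuous (union : Hyperspace (Hyperspace X) → Hyperspace X) := by
  refine continuous_of_hit _ fun U hU => ?_
  have : union ⁻¹' hit U = hit (hit U) := by
    ext 𝒞
    constructor
    · rintro ⟨x, ⟨C, hC, hx⟩, hxU⟩
      exact ⟨C, hC, x, hx, hxU⟩
    · rintro ⟨C, hC, x, hx, hxU⟩
      exact ⟨x, ⟨C, hC, hx⟩, hxU⟩
  rw [this]
  exact isClopen_hit (isClopen_hit hU)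

theorem image_id (C : Hyperspace X) : image (ContinuousMap.id X) C = C :=
  Hyperspace.ext fun x => by simp [mem_image]

theorem image_comp {Z : Type u} [TopologicalSpace Z] [CompactSpace Z] [T2Space Z]
    [TotallyDisconnectedSpace Z] (f : C(X, Y)) (g : C(Y, Z)) (C : Hyperspace X) :
    image (g.comp f) C = image g (image f C) :=
  Hyperspace.ext fun z => by simp [mem_image]

theorem singleton_apply (f : C(X, Y)) (x : X) : singleton (f x) = image f (singleton x) :=
  Hyperspace.ext fun y => by simp [mem_image, mem_singleton, eq_comm]

theorem union_image (f : C(X, Y)) (𝒞 : Hyperspace (Hyperspace X)) :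
    union (image ⟨image f, continuous_image f⟩ 𝒞) = image f (union 𝒞) :=
  Hyperspace.ext fun y => by
    simp only [mem_union, mem_image, ContinuousMap.coe_mk]
    constructor
    · rintro ⟨_, ⟨C, hC, rfl⟩, x, hx, rfl⟩
      exact ⟨x, ⟨C, hC, hx⟩, rfl⟩
    · rintro ⟨x, ⟨C, hC, hx⟩, rfl⟩
      exact ⟨_, ⟨C, hC, rfl⟩, x, hx, rfl⟩

theorem union_union (𝔠 : Hyperspace (Hyperspace (Hyperspace X))) :
    union (image ⟨union, continuous_union⟩ 𝔠) = union (union 𝔠) :=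
  Hyperspace.ext fun x => by
    simp only [mem_union, mem_image, ContinuousMap.coe_mk]
    constructor
    · rintro ⟨_, ⟨𝒞, h𝒞, rfl⟩, C, hC, hx⟩
      exact ⟨C, ⟨𝒞, h𝒞, hC⟩, hx⟩
    · rintro ⟨C, ⟨𝒞, h𝒞, hC⟩, hx⟩
      exact ⟨_, ⟨𝒞, h𝒞, rfl⟩, C, hC, hx⟩

theorem union_singleton (C : Hyperspace X) : union (singleton C) = C :=
  Hyperspace.ext fun x => by simp [mem_union, mem_singleton]

theorem union_image_singleton (C : Hyperspace X) :
    union (image ⟨singleton, continuous_singleton⟩ C) = C :=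
  Hyperspace.ext fun x => by simp [mem_union, mem_image, mem_singleton]

end Hyperspace

/-- The Vietoris monad on the category of Stone spaces: `X` is sent to its Vietoris space, continuous
maps act by direct image, the unit is `x ↦ {x}` and the multiplication is union. -/
def vietorisMonad : Monad Profinite.{u} where
  obj X := Profinite.of (Hyperspace X)
  map f := CompHausLike.ofHom _ ⟨image (ConcreteCategory.hom f), continuous_image _⟩
  map_id _ := ConcreteCategory.hom_ext _ _ fun C => image_id C
  map_comp _ _ := ConcreteCategory.hom_ext _ _ fun C => image_comp _ _ C
  η :=
    { app _ := CompHausLike.ofHom _ ⟨singleton, continuous_singleton⟩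
      naturality _ Y f := ConcreteCategory.hom_ext _ _ fun x =>
        singleton_apply (Y := Y) (ConcreteCategory.hom (C := Profinite.{u}) f) x }
  μ :=
    { app _ := CompHausLike.ofHom _ ⟨union, continuous_union⟩
      naturality _ Y f := ConcreteCategory.hom_ext _ _ fun 𝒞 =>
        union_image (Y := Y) (ConcreteCategory.hom (C := Profinite.{u}) f) 𝒞 }
  assoc _ := ConcreteCategory.hom_ext _ _ fun 𝔠 => union_union 𝔠
  left_unit _ := ConcreteCategory.hom_ext _ _ fun C => union_singleton C
  right_unit _ := ConcreteCategory.hom_ext _ _ fun C => union_image_singleton C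

/-! ## The dual adjunction between Stone spaces and join-semilattices with bottom -/

section Dual

instance boolContinuousSup : ContinuousSup Bool := ⟨continuous_of_discreteTopology⟩

instance continuousMapOrderBot (X : Type u) [TopologicalSpace X] : OrderBot C(X, Bool) where
  bot := ContinuousMap.const X ⊥
  bot_le _ := fun _ => bot_le

/-- `JSL(J, 2)` as a subspace of the product space `2^J`, with `2` discrete. -/
instance idealTopology (J : Type u) [SemilatticeSup J] [OrderBot J] : TopologicalSpace (SupBotHom J Bool) :=
  TopologicalSpace.induced (fun φ : SupBotHom J Bool => (φ : J → Bool)) inferInstance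

variable {J : Type u} [SemilatticeSup J] [OrderBot J]

theorem isEmbedding_coe : Topology.IsEmbedding (fun φ : SupBotHom J Bool => (φ : J → Bool)) :=
  ⟨⟨rfl⟩, DFunLike.coe_injective⟩

theorem isClosedEmbedding_coe :
    Topology.IsClosedEmbedding (fun φ : SupBotHom J Bool => (φ : J → Bool)) := by
  refine ⟨isEmbedding_coe, ?_⟩
  have : Set.range (fun φ : SupBotHom J Bool => (φ : J → Bool)) =
      {g : J → Bool | (∀ a b, g (a ⊔ b) = (g a ⊔ g b)) ∧ g ⊥ = ⊥} := by
    ext g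
    constructor
    · rintro ⟨φ, rfl⟩
      exact ⟨fun a b => map_sup φ a b, map_bot φ⟩
    · rintro ⟨h1, h2⟩
      exact ⟨⟨⟨g, h1⟩, h2⟩, rfl⟩
  rw [this, Set.ofPred_and, Set.ofPred_forall]
  simp only [Set.ofPred_forall]
  refine IsClosed.inter (isClosed_iInter fun a => isClosed_iInter fun b => ?_) ?_
  · exact isClosed_eq (continuous_apply _) ((continuous_apply a).sup (continuous_apply b))
  · exact isClosed_eq (continuous_apply _) continuous_const

theorem continuous_eval (a : J) : Continuous fun φ : SupBotHom J Bool => φ a :=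
  (continuous_apply a).comp isEmbedding_coe.continuous

theorem continuous_of_eval {Z : Type*} [TopologicalSpace Z] (f : Z → SupBotHom J Bool)
    (h : ∀ a, Continuous fun z => f z a) : Continuous f :=
  isEmbedding_coe.continuous_iff.2 (continuous_pi h)

instance idealCompact : CompactSpace (SupBotHom J Bool) := isClosedEmbedding_coe.compactSpace

instance idealT2 : T2Space (SupBotHom J Bool) := isEmbedding_coe.t2Space

instance idealTotallyDisconnected : TotallyDisconnectedSpace (SupBotHom J Bool) :=
  isEmbedding_coe.isTotallyDisconnected_range.1
    (isTotallyDisconnected_of_totallyDisconnectedSpace _)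

end Dual

/-- The functor `Stone(-, 2)` from Stone spaces to the opposite of the category of join-semilattices
with bottom; `2` is the discrete space `Bool`, and joins are computed pointwise. -/
def stoneHom : Profinite.{u} ⥤ SemilatSupCat.{u}ᵒᵖ where
  obj X := Opposite.op (SemilatSupCat.of C(X, Bool))
  map {X Y} f := Quiver.Hom.op (X := SemilatSupCat.of C(Y, Bool)) (Y := SemilatSupCat.of C(X, Bool))
    (⟨⟨fun g => g.comp (ConcreteCategory.hom f), fun _ _ => rfl⟩, rfl⟩ :
      SupBotHom C(Y, Bool) C(X, Bool))

/-- The functor `JSL(-, 2)` from the opposite of the category of join-semilattices with bottom to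
Stone spaces. -/
def idealSpace : SemilatSupCat.{u}ᵒᵖ ⥤ Profinite.{u} where
  obj J := Profinite.of (SupBotHom J.unop Bool)
  map {J K} h := CompHausLike.ofHom _
    (⟨fun φ => SupBotHom.comp φ h.unop,
      continuous_of_eval _ fun _ => continuous_eval _⟩ :
      C(SupBotHom J.unop Bool, SupBotHom K.unop Bool))

/-- A morphism `J → Stone(X, 2)` gives a continuous map `X → JSL(J, 2)`. -/
def transpose {X J : Type u} [TopologicalSpace X] [SemilatticeSup J] [OrderBot J]
    (h : SupBotHom J C(X, Bool)) : C(X, SupBotHom J Bool) where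
  toFun x :=
    { toFun := fun a => h a x
      map_sup' := fun a b => by rw [map_sup]; rfl
      map_bot' := by rw [map_bot]; rfl }
  continuous_toFun := continuous_of_eval _ fun a => (h a).continuous

/-- A continuous map `X → JSL(J, 2)` gives a morphism `J → Stone(X, 2)`. -/
def untranspose {X J : Type u} [TopologicalSpace X] [SemilatticeSup J] [OrderBot J]
    (f : C(X, SupBotHom J Bool)) : SupBotHom J C(X, Bool) where
  toFun a := ⟨fun x => f x a, (continuous_eval a).comp f.continuous⟩
  map_sup' a b := ContinuousMap.ext fun x => map_sup (f x) a b
  map_bot' := ContinuousMap.ext fun x => map_bot (f x)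

/-- The dual adjunction `Stone(-, 2) ⊣ JSL(-, 2)`: a continuous map `X → JSL(J, 2)` corresponds to a
morphism `J → Stone(X, 2)` by exchanging the two arguments. -/
def dualAdjunction : stoneHom.{u} ⊣ idealSpace.{u} :=
  Adjunction.mkOfHomEquiv
    { homEquiv X J :=
        { toFun h := CompHausLike.ofHom _ (transpose (X := X) (J := J.unop) h.unop)
          invFun f := Quiver.Hom.op (X := J.unop) (Y := SemilatSupCat.of C(X, Bool))
            (untranspose (X := X) (J := J.unop) (ConcreteCategory.hom (C := Profinite.{u}) f))
          left_inv _ := rfl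
          right_inv _ := rfl }
      homEquiv_naturality_left_symm _ _ := rfl
      homEquiv_naturality_right _ _ := rfl }

/-! ## Finite sets and finite powersets -/

section FinitePowerset

variable {X Y : Type u}

open scoped Classical in
/-- The direct image of a finite set. -/
def finsetMap (f : X → Y) (s : Finset X) : Finset Y := s.image f

open scoped Classical in
/-- The union of a finite set of finite sets. -/
def finsetUnion (S : Finset (Finset X)) : Finset X := S.biUnion id

theorem mem_finsetMap (f : X → Y) (s : Finset X) (y : Y) :
    y ∈ finsetMap f s ↔ ∃ x ∈ s, f x = y := by
  classical exact Finset.mem_image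

theorem mem_finsetUnion (S : Finset (Finset X)) (x : X) :
    x ∈ finsetUnion S ↔ ∃ s ∈ S, x ∈ s := by
  classical exact Finset.mem_biUnion

/-- The finite powerset monad on the category of sets: functions act by direct image, the unit is
`x ↦ {x}` and the multiplication is union. -/
def finitePowersetMonad : Monad (Type u) where
  obj X := Finset X
  map f := ↾(finsetMap f)
  map_id X := ConcreteCategory.hom_ext _ _ fun (s : Finset X) => by
    change finsetMap id s = s
    ext
    simp [mem_finsetMap]
  map_comp {X _ _} f g := ConcreteCategory.hom_ext _ _ fun (s : Finset X) => by
    change finsetMap (fun x => g (f x)) s = finsetMap g (finsetMap f s)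
    ext
    simp [mem_finsetMap]
  η :=
    { app X := ↾(fun x : X => ({x} : Finset X))
      naturality _ _ f := ConcreteCategory.hom_ext _ _ fun x => by
        change {f x} = finsetMap f {x}
        ext
        simp [mem_finsetMap, eq_comm] }
  μ :=
    { app X := ↾(finsetUnion (X := X))
      naturality X _ f := ConcreteCategory.hom_ext _ _ fun (S : Finset (Finset X)) => by
        change finsetUnion (finsetMap (finsetMap f) S) = finsetMap f (finsetUnion S)
        ext
        simp only [mem_finsetMap, mem_finsetUnion]
        grind [mem_finsetMap] }
  assoc X := ConcreteCategory.hom_ext _ _ fun (S : Finset (Finset (Finset X))) => by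
    change finsetUnion (finsetMap finsetUnion S) = finsetUnion (finsetUnion S)
    ext
    simp only [mem_finsetMap, mem_finsetUnion]
    grind [mem_finsetUnion]
  left_unit X := ConcreteCategory.hom_ext _ _ fun (s : Finset X) => by
    change finsetUnion {s} = s
    ext
    simp [mem_finsetUnion]
  right_unit X := ConcreteCategory.hom_ext _ _ fun (s : Finset X) => by
    change finsetUnion (finsetMap (fun x => {x}) s) = s
    ext
    simp [mem_finsetUnion, mem_finsetMap]

/-- The full subcategory of the Kleisli category of the finite powerset monad on the finite sets. -/
abbrev FiniteKleisli : Type (u + 1) :=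
  ObjectProperty.FullSubcategory (fun X : Kleisli finitePowersetMonad.{u} => Finite X.of)

/-- The set of finite subsets of `X` with the discrete topology. -/
def DiscretePowerset (X : Type u) : Type u := Finset X

instance discretePowersetTopology (X : Type u) : TopologicalSpace (DiscretePowerset X) := ⊥

instance discretePowersetDiscrete (X : Type u) : DiscreteTopology (DiscretePowerset X) := ⟨rfl⟩

instance discretePowersetFinite (X : Type u) [Finite X] : Finite (DiscretePowerset X) :=
  inferInstanceAs (Finite (Finset X))

instance finiteKleisliFinite (X : FiniteKleisli.{u}) : Finite X.obj.of := X.property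

/-- The functor sending a finite set `X` to the finite powerset of `X`, as a discrete space, and a
Kleisli morphism `f` to `f^#`, that is, to `P f` followed by the multiplication of the monad. -/
def kleisliToStone : FiniteKleisli.{u} ⥤ Profinite.{u} where
  obj X := Profinite.of (DiscretePowerset X.obj.of)
  map {X Y} f := CompHausLike.ofHom _
    (⟨(Kleisli.Adjunction.fromKleisli finitePowersetMonad).map f.hom,
      continuous_of_discreteTopology⟩ :
      C(DiscretePowerset X.obj.of, DiscretePowerset Y.obj.of))
  map_id X := ConcreteCategory.hom_ext _ _ fun s =>
    ConcreteCategory.congr_hom ((Kleisli.Adjunction.fromKleisli finitePowersetMonad).map_id X.obj) s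
  map_comp f g := ConcreteCategory.hom_ext _ _ fun s =>
    ConcreteCategory.congr_hom
      ((Kleisli.Adjunction.fromKleisli finitePowersetMonad).map_comp f.hom g.hom) s

end FinitePowerset

end VietorisCodensity

end

namespace VietorisCodensity

/-! ## Recognizing codensity monads -/

section Recognition

variable {A : Type u₁} {C : Type u₂} [Category.{v₁} A] [Category.{v₂} C]

/-! A closed subset of a Stone space is determined by the clopen sets that it hits, and hitting
preserves finite joins of clopen sets. Conversely, compactness shows that every morphism `φ` from
the clopen sets to `2` arises in this way, from the complement of the union of the ideal `φ⁻¹(0)`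
(`hitHom_idealCompl`, `idealCompl_hitHom`). The hit and miss sets are the coordinate conditions of
the product topology, so the bijection is a homeomorphism. It turns singletons into evaluations,
direct images into precomposition, and unions into the multiplication of the adjunction.

For the codensity monad, the pointwise formula asks for the limit of the spaces `P A` over all maps
`X ⟶ P A` with `A` finite. As `P A` is `2^A`, a cone is determined by its legs at maps to `P 1 = 2`
(`mem_coneLeg`). Kleisli morphisms act by finite joins, so compatibility makes these legs a
join-semilattice morphism from `C(X, 2)` to `C(Z, 2)`, where `Z` is the apex (`coneHom`). Its
transpose is a map from `Z` to `JSL(C(X, 2), 2)`, which is the Vietoris space by the first half.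

The monad structures agree because that of the codensity monad is fixed by its counit: it suffices
that union is a natural Eilenberg–Moore action on finite powersets (`monadIsoCodensity`). -/

/-- A monad `T` with an action `α : F ⋙ T ⟶ F` that exhibits `T` as the right Kan extension of `F`
along itself is isomorphic to the codensity monad of `F`. -/
noncomputable def monadIsoCodensity (F : A ⥤ C) [F.HasRightKanExtension F] (T : Monad C)
    (α : F ⋙ (T : C ⥤ C) ⟶ F) [(T : C ⥤ C).IsRightKanExtension α]
    (hη : ∀ a, T.η.app (F.obj a) ≫ α.app a = 𝟙 (F.obj a))
    (hμ : ∀ a, T.μ.app (F.obj a) ≫ α.app a = T.map (α.app a) ≫ α.app a) :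
    T ≅ codensityMonad F :=
  let e : (T : C ⥤ C) ≅ ranSelf F :=
    (T : C ⥤ C).rightKanExtensionUnique α (ranSelf F) (ranSelfCounit F)
  -- The comparison carries `α` to the counit. Natural transformations into `ranSelf F` are detected
  -- by composing with the counit along `F`, so both monad laws reduce to `hη` and `hμ`.
  have he (a : A) : e.hom.app (F.obj a) ≫ (ranSelfCounit F).app a = α.app a := by
    simp [e, Functor.rightKanExtensionUnique, Functor.rightKanExtensionUniqueOfIso]
  MonadIso.mk (N := codensityMonad F) e
    (fun X => by
      have h : T.η ≫ e.hom = codensityUnit F := by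
        apply (ranSelf F).hom_ext_of_isRightKanExtension (ranSelfCounit F)
        ext a
        have h1 := codensityUnit_fac F a
        simp only [Functor.whiskerLeft_app, NatTrans.comp_app, Category.assoc, he, hη, h1]
      exact NatTrans.congr_app h X)
    (fun X => by
      have h : T.μ ≫ e.hom = (Functor.whiskerRight e.hom (T : C ⥤ C) ≫
          Functor.whiskerLeft (ranSelf F) e.hom) ≫ codensityMul F := by
        apply (ranSelf F).hom_ext_of_isRightKanExtension (ranSelfCounit F)
        ext a
        have h1 := codensityMul_fac F a
        have h2 := e.hom.naturality ((ranSelfCounit F).app a)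
        simp only [Functor.whiskerLeft_app, Functor.whiskerRight_app, NatTrans.comp_app,
          Category.assoc, he, hμ, h1]
        -- Naturality of `e` at the counit brings `e` next to the last counit, giving `α`; the
        -- remaining factors combine to `T.map` of `e` followed by the counit, which is `T.map α`.
        erw [← reassoc_of% h2, he]
        rw [← he a, Functor.map_comp_assoc]
      exact NatTrans.congr_app h X)

end Recognition

/-! ## Closed sets and ideals of clopen sets -/

section Ideals

variable {X : Type u} [TopologicalSpace X]

theorem isClopen_preimage_true (g : C(X, Bool)) : IsClopen (g ⁻¹' {true}) :=
  (isClopen_discrete {true}).preimage g.continuous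

open scoped Classical in
/-- The morphism that sends `g` to `1` if and only if the closed set `C` hits `g⁻¹(1)`. -/
noncomputable def hitHom (C : Hyperspace X) : SupBotHom C(X, Bool) Bool where
  toFun g := decide (C ∈ hit (g ⁻¹' {true}))
  map_sup' g h := by
    rw [Bool.eq_iff_iff, decide_eq_true_eq]
    change _ ↔ (_ || _) = true
    rw [Bool.or_eq_true, decide_eq_true_eq, decide_eq_true_eq]
    constructor
    · rintro ⟨x, hx, hgh⟩
      rcases Bool.or_eq_true_iff.1 (show (g x || h x) = true from hgh) with h' | h'
      · exact Or.inl ⟨x, hx, h'⟩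
      · exact Or.inr ⟨x, hx, h'⟩
    · rintro (⟨x, hx, h'⟩ | ⟨x, hx, h'⟩)
      · exact ⟨x, hx, show (g x || h x) = true by rw [show g x = true from h', Bool.true_or]⟩
      · exact ⟨x, hx, show (g x || h x) = true by rw [show h x = true from h', Bool.or_true]⟩
  map_bot' := decide_eq_false fun ⟨_, _, h⟩ => Bool.false_ne_true h

theorem hitHom_eq_true {C : Hyperspace X} {g : C(X, Bool)} :
    hitHom C g = true ↔ ∃ x ∈ C, g x = true := by
  classical exact decide_eq_true_iff

theorem hitHom_eq_false {C : Hyperspace X} {g : C(X, Bool)} :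
    hitHom C g = false ↔ C ∈ miss (g ⁻¹' {true}) := by
  rw [← compl_hit]
  classical exact decide_eq_false_iff_not

/-- The coordinate of `hitHom C` at `g` is 0 or 1 according to whether `C` lies in the subbasic set
`miss` or `hit` of the clopen set `g⁻¹(1)`. -/
theorem continuous_hitHom : Continuous (hitHom (X := X)) := by
  refine continuous_of_eval _ fun g => ?_
  refine continuous_discrete_rng.2 fun b => ?_
  cases b
  · convert isOpen_miss (isClopen_preimage_true g) using 1
    ext C
    exact hitHom_eq_false
  · convert isOpen_hit (isClopen_preimage_true g) using 1
    ext C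
    exact hitHom_eq_true

/-- The closed set of the points that lie in no clopen set of the ideal `φ⁻¹(0)`. -/
def idealCompl (φ : SupBotHom C(X, Bool) Bool) : Hyperspace X :=
  (⟨⋂ g : {g : C(X, Bool) // φ g = false}, g.1 ⁻¹' {false},
    isClosed_iInter fun g => isClosed_singleton.preimage g.1.continuous⟩ :
      TopologicalSpace.Closeds X)

theorem mem_idealCompl {φ : SupBotHom C(X, Bool) Bool} {x : X} :
    x ∈ idealCompl φ ↔ ∀ g, φ g = false → g x = false := by
  change x ∈ ⋂ g : {g : C(X, Bool) // φ g = false}, g.1 ⁻¹' {false} ↔ _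
  simp

/-- The substantial direction is compactness. If `φ g = 1` but `idealCompl φ` missed `g⁻¹(1)`, the
members of the ideal would cover this compact set. The ideal is directed under joins, so a single
`h` with `φ h = 0` would satisfy `g ≤ h`, against monotonicity of `φ`. -/
theorem hitHom_idealCompl [CompactSpace X] (φ : SupBotHom C(X, Bool) Bool) :
    hitHom (idealCompl φ) = φ := by
  refine DFunLike.ext _ _ fun g => ?_
  rw [Bool.eq_iff_iff, hitHom_eq_true]
  constructor
  · rintro ⟨x, hx, hg⟩
    by_contra h
    simp [mem_idealCompl.1 hx g (by simpa using h)] at hg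
  · intro hg
    by_contra! hC
    have hcov : g ⁻¹' {true} ⊆ ⋃ h : {h : C(X, Bool) // φ h = false}, h.1 ⁻¹' {true} := by
      intro x hx
      have hx' : x ∉ idealCompl φ := fun h => hC x h hx
      rw [mem_idealCompl] at hx'
      push Not at hx'
      obtain ⟨h, hφ, hhx⟩ := hx'
      exact Set.mem_iUnion.2 ⟨⟨h, hφ⟩, by simpa using hhx⟩
    -- Extracting one member from a directed cover needs a nonempty index type; the ideal contains
    -- `⊥`.
    have : Nonempty {h : C(X, Bool) // φ h = false} := ⟨⟨⊥, map_bot φ⟩⟩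
    obtain ⟨⟨h, hφ⟩, hgh⟩ := (isClopen_preimage_true g).isClosed.isCompact.elim_directed_cover
      (fun h : {h : C(X, Bool) // φ h = false} => h.1 ⁻¹' {true}) (fun h => (isClopen_preimage_true h.1).isOpen) hcov (fun a b => by
        refine ⟨⟨a.1 ⊔ b.1, by rw [map_sup, a.2, b.2]; rfl⟩, fun x hx => ?_, fun x hx => ?_⟩
        · change (a.1 x || b.1 x) = true
          rw [show a.1 x = true from hx, Bool.true_or]
        · change (a.1 x || b.1 x) = true
          rw [show b.1 x = true from hx, Bool.or_true])
    have hle : g ≤ h := fun x => by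
      have := @hgh x
      change g x ≤ h x
      cases hg' : g x
      · exact Bool.false_le _
      · exact (show h x = true from this hg').ge
    have := OrderHomClass.mono φ hle
    rw [hg, hφ] at this
    exact absurd this (by decide)

/-- A point outside `C` has a clopen neighbourhood that `C` misses; its indicator belongs to the
ideal and takes the value 1 at the point. -/
theorem idealCompl_hitHom [CompactSpace X] [T2Space X] [TotallyDisconnectedSpace X]
    (C : Hyperspace X) : idealCompl (hitHom C) = C := by
  refine Hyperspace.ext fun x => ⟨fun hx => ?_, fun hx => ?_⟩
  · by_contra hxC
    obtain ⟨U, hU, hxU, hCU⟩ := exists_clopen_of_notMem C hxC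
    classical
    let g : C(X, Bool) := ⟨fun y => decide (y ∈ U), continuous_bool_rng true |>.2 (by
      convert hU using 1
      ext; simp)⟩
    have hgU : g ⁻¹' {true} = U := by ext; simp [g]
    have := mem_idealCompl.1 hx g (hitHom_eq_false.2 (by rwa [hgU]))
    simp [g, hxU] at this
  · refine mem_idealCompl.2 fun g hg => ?_
    by_contra h
    have : x ∈ (C : Set X) ∩ g ⁻¹' {true} := ⟨hx, by simpa using h⟩
    rw [show (C : Set X) ∩ g ⁻¹' {true} = ∅ from hitHom_eq_false.1 hg] at this
    exact this

/-- Closed sets correspond to ideals of clopen sets. -/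
noncomputable def hyperspaceHomeo [CompactSpace X] [T2Space X] [TotallyDisconnectedSpace X] :
    Hyperspace X ≃ₜ SupBotHom C(X, Bool) Bool :=
  Continuous.homeoOfEquivCompactToT2
    (f := ⟨hitHom, idealCompl, idealCompl_hitHom, hitHom_idealCompl⟩) continuous_hitHom

end Ideals

/-- The isomorphism between the Vietoris monad and the monad of the dual adjunction. -/
noncomputable def vietorisIso : vietorisMonad.{u} ≅ dualAdjunction.{u}.toMonad :=
  MonadIso.mk
    (NatIso.ofComponents
      (fun X => CompHausLike.isoOfHomeo
        (X := Profinite.of (Hyperspace X)) (Y := Profinite.of (SupBotHom C(X, Bool) Bool))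
        hyperspaceHomeo)
      (fun {X Y} f => ConcreteCategory.hom_ext _ _ fun (C : Hyperspace X) =>
        DFunLike.ext (F := SupBotHom C(Y, Bool) Bool) _ _ fun g => by
          change hitHom (image (Y := Y) (ConcreteCategory.hom (C := Profinite.{u}) f) C) g =
            hitHom C (g.comp (ConcreteCategory.hom (C := Profinite.{u}) f))
          rw [Bool.eq_iff_iff, hitHom_eq_true, hitHom_eq_true]
          simp [mem_image]))
    (fun X => ConcreteCategory.hom_ext _ _ fun (x : X) =>
      DFunLike.ext (F := SupBotHom C(X, Bool) Bool) _ _ fun g => by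
        change hitHom (singleton x) g = g x
        rw [Bool.eq_iff_iff, hitHom_eq_true]
        simp [mem_singleton])
    (fun X => ConcreteCategory.hom_ext _ _ fun (𝒞 : Hyperspace (Hyperspace X)) =>
      DFunLike.ext (F := SupBotHom C(X, Bool) Bool) _ _ fun g => by
        -- The multiplication of the adjunction monad evaluates a morphism at the map `φ ↦ φ g`, so
        -- both sides say that some member of `𝒞` hits `g⁻¹(1)`.
        change hitHom (union 𝒞) g = hitHom (image ⟨hitHom, continuous_hitHom⟩ 𝒞)
          ⟨fun φ => φ g, continuous_eval g⟩
        rw [Bool.eq_iff_iff, hitHom_eq_true, hitHom_eq_true]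
        simp only [mem_union, mem_image, ContinuousMap.coe_mk, exists_exists_and_eq_and,
          hitHom_eq_true]
        grind)

end VietorisCodensity
namespace VietorisCodensity

/-! ## The right Kan extension of `kleisliToStone` along itself -/

/-! ### Finite powersets as powers of `2`, and unions of closed families in them. -/

section FiniteSets

variable {A : Type u}

/-- The finite set underlying a point of the discrete powerset. -/
def elems (s : DiscretePowerset A) : Finset A := s

open scoped Classical in
/-- Finite powersets of finite sets are powers of the discrete space `2`. -/
noncomputable def powersetHomeo (A : Type u) [Finite A] : DiscretePowerset A ≃ₜ (A → Bool) where
  toFun s a := decide (a ∈ elems s)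
  invFun p := ({a | p a = true} : Set A).toFinite.toFinset
  left_inv s := by
    refine Finset.ext (α := A) fun a => ?_
    rw [Set.Finite.mem_toFinset]
    exact decide_eq_true_iff
  right_inv p := by
    funext a
    rw [Bool.eq_iff_iff, decide_eq_true_eq]
    exact Set.Finite.mem_toFinset _
  continuous_toFun := continuous_of_discreteTopology
  continuous_invFun := continuous_of_discreteTopology

theorem powersetHomeo_apply [Finite A] (s : Finset A) (a : A) :
    powersetHomeo A s a = true ↔ a ∈ s := by
  classical exact decide_eq_true_iff

theorem mem_powersetHomeo_symm [Finite A] (p : A → Bool) (a : A) :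
    a ∈ elems (A := A) ((powersetHomeo A).symm p) ↔ p a = true := by
  rw [← powersetHomeo_apply]
  change powersetHomeo A ((powersetHomeo A).symm p) a = true ↔ _
  rw [Homeomorph.apply_symm_apply]

/-- The continuous map `P A → 2` that tests whether `a` is an element. -/
noncomputable def memMap [Finite A] (a : A) : C(DiscretePowerset A, Bool) :=
  ⟨fun s => powersetHomeo A s a, continuous_of_discreteTopology⟩

/-- The union of a closed set of subsets of a finite set. -/
noncomputable def powersetUnion [Finite A] (C : Hyperspace (DiscretePowerset A)) :
    DiscretePowerset A :=
  -- An element lies in the union exactly when `C` hits the clopen set of subsets containing it; in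
  -- this form continuity follows from `continuous_hitHom`.
  (powersetHomeo A).symm fun a => hitHom C (memMap a)

theorem mem_powersetUnion [Finite A] (C : Hyperspace (DiscretePowerset A)) (a : A) :
    a ∈ elems (A := A) (powersetUnion C) ↔ ∃ s ∈ C, a ∈ elems s := by
  rw [powersetUnion, mem_powersetHomeo_symm, hitHom_eq_true]
  exact exists_congr fun s => and_congr_right fun _ => powersetHomeo_apply _ _

theorem continuous_powersetUnion [Finite A] : Continuous (powersetUnion (A := A)) :=
  (powersetHomeo A).symm.continuous.comp
    (continuous_pi fun a => (continuous_eval (memMap a)).comp continuous_hitHom)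

end FiniteSets

/-! ### Kleisli morphisms and the action of the Vietoris monad on finite powersets. -/

section KanExtension

/-- The Kleisli morphism given by a function `A → P B`. -/
noncomputable def kleisliHom {A B : FiniteKleisli.{u}} (k : A.obj.of → Finset B.obj.of) : A ⟶ B :=
  ObjectProperty.homMk (.mk (↾k))

theorem exists_kleisliHom {A B : FiniteKleisli.{u}} (f : A ⟶ B) :
    ∃ k : A.obj.of → Finset B.obj.of, f = kleisliHom k :=
  ⟨ConcreteCategory.hom f.hom.of, rfl⟩

theorem mem_map_kleisliHom {A B : FiniteKleisli.{u}} (k : A.obj.of → Finset B.obj.of)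
    (s : Finset A.obj.of) (b : B.obj.of) :
    b ∈ elems (A := B.obj.of) (kleisliToStone.map (kleisliHom k) s) ↔ ∃ a ∈ s, b ∈ k a := by
  change b ∈ finsetUnion (finsetMap k s) ↔ _
  simp only [mem_finsetUnion, mem_finsetMap, exists_exists_and_eq_and]

theorem powerset_hom_ext {A : FiniteKleisli.{u}} {Z : Profinite.{u}}
    {f g : Z ⟶ kleisliToStone.obj A}
    (h : ∀ (z : Z) (a : A.obj.of), a ∈ elems (A := A.obj.of) (f z) ↔
      a ∈ elems (A := A.obj.of) (g z)) : f = g :=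
  ConcreteCategory.hom_ext _ _ fun z => Finset.ext (α := A.obj.of) (h z)

/-- The action of the Vietoris monad on finite powersets by unions. -/
noncomputable def vietorisAction :
    kleisliToStone.{u} ⋙ (vietorisMonad.{u} : Profinite.{u} ⥤ Profinite.{u}) ⟶
      kleisliToStone.{u} where
  app A := CompHausLike.ofHom _ (⟨powersetUnion, continuous_powersetUnion⟩ :
    C(Hyperspace (DiscretePowerset A.obj.of), DiscretePowerset A.obj.of))
  naturality A B f := by
    obtain ⟨k, rfl⟩ := exists_kleisliHom f
    refine powerset_hom_ext fun (C : Hyperspace (DiscretePowerset A.obj.of)) b => ?_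
    change b ∈ elems (A := B.obj.of) (powersetUnion (image (Y := DiscretePowerset B.obj.of)
        (ConcreteCategory.hom (C := Profinite.{u}) (kleisliToStone.map (kleisliHom k))) C)) ↔
      b ∈ elems (A := B.obj.of) (kleisliToStone.map (kleisliHom k) (powersetUnion C))
    refine (mem_powersetUnion _ b).trans (Iff.trans ?_ (mem_map_kleisliHom k _ b).symm)
    constructor
    · rintro ⟨_, ⟨s, hs, rfl⟩, hb⟩
      obtain ⟨a, ha, hb⟩ := (mem_map_kleisliHom k s b).1 hb
      exact ⟨a, (mem_powersetUnion C a).2 ⟨s, hs, ha⟩, hb⟩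
    · rintro ⟨a, ha, hb⟩
      obtain ⟨s, hs, ha⟩ := (mem_powersetUnion C a).1 ha
      exact ⟨_, ⟨s, hs, rfl⟩, (mem_map_kleisliHom k s b).2 ⟨a, ha, hb⟩⟩

theorem mem_vietorisAction {A : FiniteKleisli.{u}} (C : Hyperspace (DiscretePowerset A.obj.of))
    (a : A.obj.of) :
    a ∈ elems (A := A.obj.of) (vietorisAction.app A C) ↔
      ∃ s ∈ C, a ∈ elems s :=
  mem_powersetUnion C a

/-- A finite set as an object of the Kleisli category. -/
noncomputable abbrev finiteKleisliOf (A : Type u) [h : Finite A] : FiniteKleisli.{u} :=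
  ⟨Kleisli.mk finitePowersetMonad A, h⟩

/-! ### Maps into a finite powerset as families of maps to `2`. -/

variable {X : Profinite.{u}}

/-- The continuous map `X → P A` given by a family of continuous maps `X → 2`. -/
noncomputable def familyHom {A : FiniteKleisli.{u}} (g : A.obj.of → C(X, Bool)) :
    X ⟶ kleisliToStone.obj A :=
  CompHausLike.ofHom _ (⟨fun x => (powersetHomeo A.obj.of).symm fun a => g a x,
    (powersetHomeo A.obj.of).symm.continuous.comp (continuous_pi fun a => (g a).continuous)⟩ :
    C(X, DiscretePowerset A.obj.of))

theorem mem_familyHom {A : FiniteKleisli.{u}} (g : A.obj.of → C(X, Bool)) (x : X)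
    (a : A.obj.of) : a ∈ elems (A := A.obj.of) (familyHom g x) ↔ g a x = true :=
  mem_powersetHomeo_symm _ a

/-- The components of a continuous map `X → P A`. -/
noncomputable def component {A : FiniteKleisli.{u}} (f : X ⟶ kleisliToStone.obj A)
    (a : A.obj.of) : C(X, Bool) :=
  (memMap a).comp (ConcreteCategory.hom (C := Profinite.{u}) f :
    C(X, DiscretePowerset A.obj.of))

theorem component_apply {A : FiniteKleisli.{u}} (f : X ⟶ kleisliToStone.obj A) (a : A.obj.of)
    (x : X) : component f a x = true ↔ a ∈ elems (A := A.obj.of) (f x) :=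
  powersetHomeo_apply _ _

theorem component_familyHom {A : FiniteKleisli.{u}} (g : A.obj.of → C(X, Bool))
    (a : A.obj.of) : component (familyHom g) a = g a :=
  ContinuousMap.ext fun x => by
    rw [Bool.eq_iff_iff, component_apply, mem_familyHom]

/-- A continuous map `X → 2`, as a map to the powerset of a point. -/
noncomputable abbrev pointHom (g : C(X, Bool)) :
    X ⟶ kleisliToStone.obj (finiteKleisliOf PUnit.{u + 1}) :=
  familyHom fun _ => g

/-! ### Cones as join-semilattice morphisms. -/

variable (s : Limits.Cone (StructuredArrow.proj X kleisliToStone.{u} ⋙ kleisliToStone.{u}))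

/-- The leg of a cone at a map `X → P A`. -/
noncomputable abbrev coneLeg {A : FiniteKleisli.{u}} (f : X ⟶ kleisliToStone.obj A) :
    s.pt ⟶ kleisliToStone.obj A :=
  s.π.app (StructuredArrow.mk f)

/-- The hypothesis `h` is the commutative triangle that makes `k` a morphism of structured arrows
from `f` to `g`; the conclusion is the compatibility of the cone with it. All later facts about
cones come from choosing `k`. -/
theorem mem_coneLeg_iff {A B : FiniteKleisli.{u}} {f : X ⟶ kleisliToStone.obj A}
    {g : X ⟶ kleisliToStone.obj B} (k : A.obj.of → Finset B.obj.of)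
    (h : ∀ x b, b ∈ elems (A := B.obj.of) (g x) ↔
      ∃ a ∈ elems (A := A.obj.of) (f x), b ∈ k a) (z : s.pt) (b : B.obj.of) :
    b ∈ elems (A := B.obj.of) (coneLeg s g z) ↔
      ∃ a ∈ elems (A := A.obj.of) (coneLeg s f z), b ∈ k a := by
  have hfg : f ≫ kleisliToStone.map (kleisliHom k) = g := powerset_hom_ext fun x b =>
    (mem_map_kleisliHom k (f x) b).trans (h x b).symm
  have hw : coneLeg s f ≫ kleisliToStone.map (kleisliHom k) = coneLeg s g :=
    s.w (StructuredArrow.homMk (kleisliHom k) hfg :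
      StructuredArrow.mk f ⟶ StructuredArrow.mk g)
  rw [← hw]
  exact mem_map_kleisliHom k (coneLeg s f z) b

/-- The value of the cone at a map `X → 2`. -/
noncomputable def coneValue (g : C(X, Bool)) : C(s.pt, Bool) :=
  component (coneLeg s (pointHom g)) PUnit.unit

-- The Kleisli morphism to a point that sends `a` to the full set and every other element to `∅`
-- induces the membership test `P A ⟶ P 1` at `a`. Hence the legs at maps to `2` determine all
-- others.
open scoped Classical in
theorem mem_coneLeg {A : FiniteKleisli.{u}} (f : X ⟶ kleisliToStone.obj A) (z : s.pt)
    (a : A.obj.of) :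
    a ∈ elems (A := A.obj.of) (coneLeg s f z) ↔ coneValue s (component f a) z = true := by
  rw [coneValue, component_apply]
  rw [mem_coneLeg_iff s (f := f) (B := finiteKleisliOf PUnit.{u + 1}) 
    (fun a' => if a' = a then ({PUnit.unit} : Finset PUnit) else ∅)]
  · constructor
    · intro h
      exact ⟨a, h, by simp⟩
    · rintro ⟨a', h, ha'⟩
      by_cases haa : a' = a
      · rwa [← haa]
      · simp [haa] at ha'
  · intro x b
    rw [mem_familyHom, component_apply]
    constructor
    · intro h
      exact ⟨a, h, by simp⟩
    · rintro ⟨a', h, ha'⟩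
      by_cases haa : a' = a
      · rwa [← haa]
      · simp [haa] at ha'

theorem coneValue_sup (g h : C(X, Bool)) (z : s.pt) :
    coneValue s (g ⊔ h) z = (coneValue s g z ⊔ coneValue s h z) := by
  let A : FiniteKleisli.{u} := finiteKleisliOf (ULift.{u} Bool)
  -- The pair `(g, h)` becomes one map into the powerset of a two-element set. The constant Kleisli
  -- morphism to the full point then induces the binary join `2 × 2 ⟶ 2`, while the membership tests
  -- recover `g` and `h`.
  let p (i : A.obj.of) : C(X, Bool) := cond (ULift.down i) g h
  have hp (i : A.obj.of) : i ∈ elems (A := A.obj.of) (coneLeg s (familyHom p) z) ↔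
      coneValue s (p i) z = true := by
    rw [mem_coneLeg, component_familyHom]
  have hg : p ⟨true⟩ = g := rfl
  have hh : p ⟨false⟩ = h := rfl
  rw [Bool.eq_iff_iff, coneValue, component_apply, mem_coneLeg_iff s (f := familyHom p)
    (B := finiteKleisliOf PUnit.{u + 1}) (fun _ => ({PUnit.unit} : Finset PUnit))]
  · change _ ↔ (coneValue s g z || coneValue s h z) = true
    rw [Bool.or_eq_true_iff]
    constructor
    · rintro ⟨⟨_ | _⟩, hi, -⟩
      · exact Or.inr (hh ▸ (hp ⟨false⟩).1 hi)
      · exact Or.inl (hg ▸ (hp ⟨true⟩).1 hi)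
    · rintro (hi | hi)
      · exact ⟨⟨true⟩, (hp ⟨true⟩).2 (by rwa [hg]), Finset.mem_singleton_self _⟩
      · exact ⟨⟨false⟩, (hp ⟨false⟩).2 (by rwa [hh]), Finset.mem_singleton_self _⟩
  · intro x b
    refine (mem_familyHom _ x b).trans ?_
    change (g x || h x) = true ↔ _
    rw [Bool.or_eq_true_iff]
    constructor
    · rintro (hi | hi)
      · exact ⟨⟨true⟩, (mem_familyHom p x _).2 hi, Finset.mem_singleton_self _⟩
      · exact ⟨⟨false⟩, (mem_familyHom p x _).2 hi, Finset.mem_singleton_self _⟩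
    · rintro ⟨⟨_ | _⟩, hi, -⟩
      · exact Or.inr ((mem_familyHom p x _).1 hi)
      · exact Or.inl ((mem_familyHom p x _).1 hi)

theorem coneValue_bot (z : s.pt) : coneValue s ⊥ z = ⊥ := by
  refine Bool.eq_false_iff.2 fun h => ?_
  -- The empty Kleisli morphism induces the constant map `∅`, and `pointHom ⊥` is unchanged by
  -- composing with it, so the leg there is empty too.
  rw [coneValue, component_apply, mem_coneLeg_iff s (f := pointHom ⊥) (B := finiteKleisliOf PUnit.{u + 1})
    (fun _ => (∅ : Finset PUnit))] at h
  · obtain ⟨_, -, h⟩ := h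
    exact absurd h (Finset.notMem_empty _)
  · intro x b
    rw [mem_familyHom]
    constructor
    · intro h
      exact absurd h Bool.false_ne_true
    · rintro ⟨_, -, h⟩
      exact absurd h (Finset.notMem_empty _)

/-- The values of a cone at maps `X → 2`, as a morphism of join-semilattices. -/
noncomputable def coneHom : SupBotHom C(X, Bool) C(s.pt, Bool) where
  toFun := coneValue s
  map_sup' g h := ContinuousMap.ext (coneValue_sup s g h)
  map_bot' := ContinuousMap.ext (coneValue_bot s)

/-! ### The universal property of the Vietoris space. -/

/-- The comparison map from a cone to the Vietoris space. -/
noncomputable def coneLift : s.pt ⟶ vietorisMonad.obj X :=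
  CompHausLike.ofHom _ (((hyperspaceHomeo (X := X)).symm : C(_, Hyperspace X)).comp
    (transpose (coneHom s)))

theorem hitHom_coneLift (z : s.pt) (g : C(X, Bool)) :
    hitHom (X := X) (coneLift s z) g = coneValue s g z :=
  DFunLike.congr_fun (hyperspaceHomeo.apply_symm_apply (transpose (coneHom s) z)) g

/-- This identifies the legs of the candidate limit cone: `a` lies in the union of the direct image
of `C` when `C` hits the clopen set of points whose image contains `a`. -/
theorem mem_map_comp_vietorisAction {A : FiniteKleisli.{u}} (f : X ⟶ kleisliToStone.obj A)
    (C : Hyperspace X) (a : A.obj.of) :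
    a ∈ elems (A := A.obj.of) ((vietorisMonad.map f ≫ vietorisAction.app A) C) ↔
      hitHom C (component f a) = true := by
  rw [hitHom_eq_true]
  refine (mem_vietorisAction (image (Y := DiscretePowerset A.obj.of)
    (ConcreteCategory.hom (C := Profinite.{u}) f) C) a).trans ?_
  simp only [component_apply]
  constructor
  · rintro ⟨_, ⟨x, hx, rfl⟩, ha⟩
    exact ⟨x, hx, ha⟩
  · rintro ⟨x, hx, ha⟩
    exact ⟨_, ⟨x, hx, rfl⟩, ha⟩

/-- The Vietoris monad is a pointwise right Kan extension of `kleisliToStone` along itself. -/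
noncomputable def vietorisIsPointwise :
    (Functor.RightExtension.mk _ vietorisAction.{u}).IsPointwiseRightKanExtension := fun X =>
  { lift := fun s => coneLift s
    fac := fun s f => powerset_hom_ext fun z a => by
      refine (mem_map_comp_vietorisAction (X := X) f.hom (coneLift s z) a).trans ?_
      rw [hitHom_coneLift]
      exact (mem_coneLeg s f.hom z a).symm
    uniq := fun s m hm => ConcreteCategory.hom_ext _ _ fun z => by
      refine (hyperspaceHomeo (X := X)).injective (DFunLike.ext _ _ fun g => ?_)
      change hitHom (X := X) (m z) g = hitHom (X := X) (coneLift s z) g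
      -- The factorization condition at the single leg `pointHom g` fixes the value of `hitHom (m
      -- z)` at `g`, and these values determine the closed set `m z`.
      rw [hitHom_coneLift, Bool.eq_iff_iff, coneValue, component_apply, coneLeg, ← hm]
      refine Iff.trans ?_ (mem_map_comp_vietorisAction (X := X) (pointHom g) (m z)
        PUnit.unit).symm
      rw [component_familyHom] }

/-- The Vietoris monad is the codensity monad of `kleisliToStone`. -/
noncomputable def vietorisIsoCodensity
    [kleisliToStone.{u}.HasRightKanExtension kleisliToStone.{u}] :
    vietorisMonad.{u} ≅ codensityMonad kleisliToStone.{u} :=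
  have : (vietorisMonad.{u} : Profinite.{u} ⥤ Profinite.{u}).IsRightKanExtension
      vietorisAction.{u} := vietorisIsPointwise.isRightKanExtension
  monadIsoCodensity kleisliToStone vietorisMonad vietorisAction
    (fun A => powerset_hom_ext fun (t : DiscretePowerset A.obj.of) a => by
      refine (mem_powersetUnion (singleton t) a).trans ?_
      simp only [mem_singleton, exists_eq_left]
      rfl)
    (fun A => powerset_hom_ext fun (𝒞 : Hyperspace (Hyperspace (DiscretePowerset A.obj.of))) a => by
      refine (mem_powersetUnion (union 𝒞) a).trans
        (Iff.trans ?_ (mem_powersetUnion (image ⟨_, continuous_powersetUnion⟩ 𝒞) a).symm)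
      constructor
      · rintro ⟨t, ⟨C, hC, ht⟩, ha⟩
        exact ⟨_, ⟨C, hC, rfl⟩, (mem_powersetUnion C a).2 ⟨t, ht, ha⟩⟩
      · rintro ⟨_, ⟨C, hC, rfl⟩, ha⟩
        obtain ⟨t, ht, ha⟩ := (mem_powersetUnion C a).1 ha
        exact ⟨t, ⟨C, hC, ht⟩, ha⟩)

end KanExtension

end VietorisCodensity

theorem mainTheorem10 :
    -- The Vietoris monad is the monad induced by the dual adjunction, so that `V X` is homeomorphic to
    -- `JSL(Stone(X, 2), 2)`: the closed set `C` corresponds to the morphism whose zero set is the ideal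
    -- of all clopen sets that `C` misses.
    (∃ e : VietorisCodensity.vietorisMonad.{u} ≅ VietorisCodensity.dualAdjunction.{u}.toMonad,
      ∀ (X : Profinite.{u}) (C : VietorisCodensity.Hyperspace X) (g : C(X, Bool)),
        DFunLike.coe (F := SupBotHom C(X, Bool) Bool) (e.hom.app X C) g = false ↔
          C ∈ VietorisCodensity.miss (g ⁻¹' {true})) ∧
    -- The functor `U` sends a finite set `X` to the discrete space `2^X`.
    (∀ X : VietorisCodensity.FiniteKleisli.{u},
      ∃ h : VietorisCodensity.kleisliToStone.obj X ≃ₜ (X.obj.of → Bool),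
        ∀ (s : Finset X.obj.of) (x : X.obj.of), h s x = true ↔ x ∈ s) ∧
    -- The codensity monad of `U` exists, is pointwise, and is isomorphic to the Vietoris monad.
    ∃ _ : VietorisCodensity.kleisliToStone.{u}.HasPointwiseRightKanExtension
        VietorisCodensity.kleisliToStone.{u},
      Nonempty (VietorisCodensity.vietorisMonad.{u} ≅
        VietorisCodensity.codensityMonad VietorisCodensity.kleisliToStone.{u}) := by
  refine ⟨⟨VietorisCodensity.vietorisIso, fun X C g => VietorisCodensity.hitHom_eq_false⟩,
    fun X => ⟨VietorisCodensity.powersetHomeo X.obj.of,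
      VietorisCodensity.powersetHomeo_apply⟩, ?_⟩
  have h := VietorisCodensity.vietorisIsPointwise.{u}
  have hPointwise := h.hasPointwiseRightKanExtension
  exact ⟨hPointwise, ⟨VietorisCodensity.vietorisIsoCodensity⟩⟩
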